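/- Let \(I(x,y,z)=x^2+y^2+z^2-2xyz-1\) be the Fricke–Vogt invariant. Let \(\mathcal A\) be the set of all polynomial maps \(A\in\mathbb C[x,y,z]^3\), regarded as maps \(\mathbb C^3\to\mathbb C^3\), with \(I\circ A=I\), and let \(\mathcal G\subset\mathcal A\) be the set of Nielsen trace maps, i.e. of the polynomial maps \(F\in\mathbb Z[x,y,z]^3\) with \(I\circ F=I\) and \(F(1,1,1)=(1,1,1)\). Let \(\Sigma=\{\mathrm{Id},\sigma_1,\sigma_2,\sigma_3\}\) be the Klein four-group with \(\sigma_1(x,y,z)=(x,-y,-z)\), \(\sigma_2(x,y,z)=(-x,y,-z)\), \(\sigma_3(x,y,z)=(-x,-y,z)\). For an invertible map \(F\) of \(\mathbb C^3\) and \(\mathcal B\in\{\mathcal A,\mathcal G\}\), let \(\mathcal S_{\mathcal B}(F)\) be the set of symmetries of \(F\) in \(\mathcal B\), i.e. of the invertible maps \(S:\mathbb C^3\to\mathbb C^3\) in \(\mathcal B\) with \(F\circ S=S\circ F\). Let \(\mathcal R_{\mathcal B}(F)\) be the union of \(\mathcal S_{\mathcal B}(F)\) with the set of reversing symmetries of \(F\)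 in \(\mathcal B\), i.e. of the invertible maps \(G\) in \(\mathcal B\) with \(G\circ F\circ G^{-1}=F^{-1}\). Let \(K_\Sigma(F)=\{g\in\Sigma : g\circ F=F\circ g\}\). **Theorem 3.** Every Nielsen trace map \(F\in\mathcal G\) is an invertible map of \(\mathbb C^3\). The sets \(K_\Sigma(F)\), \(\mathcal S_{\mathcal G}(F)\) and \(\mathcal S_{\mathcal A}(F)\) are groups under composition, and \[\mathcal S_{\mathcal A}(F)=K_\Sigma(F)\rtimes\mathcal S_{\mathcal G}(F)\] as an internal semidirect product, with \(K_\Sigma(F)\) as the normal factor. If \(F\) is truly reversible, i.e. \(F^2\neq\mathrm{Id}\) and \(F\) has a reversing symmetry in \(\mathcal A\), then \(\mathcal R_{\mathcal G}(F)\) and \(\mathcal R_{\mathcal A}(F)\) are groups as well, and \[\mathcal R_{\mathcal A}(F)=K_\Sigma(F)\rtimes\mathcal R_{\mathcal G}(F)\] as an internal semidirect product, with \(K_\Sigma(F)\) as the normal factor. -/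

import Mathlib

namespace TraceMap

/-- Complex 3-space, with coordinates `(x, y, z) = (v 0, v 1, v 2)`. -/
abbrev Space : Type := Fin 3 → ℂ

/-- The Fricke–Vogt invariant `I(x, y, z) = x² + y² + z² - 2xyz - 1`. -/
def frickeVogt (v : Space) : ℂ :=
  v 0 ^ 2 + v 1 ^ 2 + v 2 ^ 2 - 2 * v 0 * v 1 * v 2 - 1

/-- `F` is given by a triple of polynomials in `R[x, y, z]`. -/
def IsPolynomialMap (R : Type) [CommRing R] [Algebra R ℂ] (F : Space → Space) : Prop :=
  ∃ p : Fin 3 → MvPolynomial (Fin 3) R, ∀ v i, F v i = MvPolynomial.aeval v (p i)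

/-- The set `𝒢` of Nielsen trace maps: the polynomial maps with integer coefficients that
preserve the Fricke–Vogt invariant and fix the point `(1, 1, 1)`. -/
def nielsenMaps : Set (Space → Space) :=
  {F | IsPolynomialMap ℤ F ∧ (∀ v, frickeVogt (F v) = frickeVogt v) ∧
    F (fun _ => 1) = fun _ => 1}

/-- The set `𝒜` of complex polynomial maps that preserve the Fricke–Vogt invariant. -/
def invariantMaps : Set (Space → Space) :=
  {A | IsPolynomialMap ℂ A ∧ ∀ v, frickeVogt (A v) = frickeVogt v}

/-- The symmetries of `F` within the class `B`: the invertible transformations of 3-space that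
belong to `B` and commute with `F`. -/
def symmetries (B : Set (Space → Space)) (F : Equiv.Perm Space) : Set (Equiv.Perm Space) :=
  {S | ⇑S ∈ B ∧ F * S = S * F}

/-- The reversing symmetries of `F` within the class `B`: the invertible transformations of
3-space that belong to `B` and conjugate `F` into its inverse. -/
def reversingSymmetries (B : Set (Space → Space)) (F : Equiv.Perm Space) :
    Set (Equiv.Perm Space) :=
  {G | ⇑G ∈ B ∧ G * F * G⁻¹ = F⁻¹}

/-- The underlying set of the reversing symmetry group of `F` within the class `B`: all
symmetries and reversing symmetries together. -/
def reversingSymmetryGroup (B : Set (Space → Space)) (F : Equiv.Perm Space) :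
    Set (Equiv.Perm Space) :=
  symmetries B F ∪ reversingSymmetries B F

/-- `F` is truly reversible within the class `B`: it has a reversing symmetry in `B` and
`F² ≠ Id`. -/
def IsTrulyReversible (B : Set (Space → Space)) (F : Equiv.Perm Space) : Prop :=
  (reversingSymmetries B F).Nonempty ∧ F ^ 2 ≠ 1

/-- The involution that keeps the coordinate `i` and changes the sign of the other two;
for instance `(x, y, z) ↦ (x, -y, -z)` for `i = 0`. -/
def signChange (i : Fin 3) : Equiv.Perm Space :=
  Function.Involutive.toPerm (fun v j => if j = i then v j else -v j) (by
    intro v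
    funext j
    by_cases h : j = i <;> simp [h])

/-- Klein's four-group `Σ = {Id, σ₁, σ₂, σ₃}`. -/
def kleinFour : Set (Equiv.Perm Space) :=
  {1, signChange 0, signChange 1, signChange 2}

/-- `K_Σ(F)`, the set of elements of `Σ` that commute with `F`. -/
def kleinCentralizer (F : Equiv.Perm Space) : Set (Equiv.Perm Space) :=
  {g | g ∈ kleinFour ∧ g * F = F * g}

/-- `S` is a subgroup of `Γ` and is the internal semidirect product `N ⋊ H`: `N` and `H` are
subgroups contained in `S`, `N` is normal in `S`, and every element of `S` is in exactly one way
a product of an element of `N` and an element of `H`. -/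
def IsSemidirect {Γ : Type} [Group Γ] (S N H : Set Γ) : Prop :=
  ∃ S' N' H' : Subgroup Γ, (S' : Set Γ) = S ∧ (N' : Set Γ) = N ∧ (H' : Set Γ) = H ∧
    N' ≤ S' ∧ H' ≤ S' ∧ (N'.subgroupOf S').Normal ∧
    (N'.subgroupOf S').IsComplement' (H'.subgroupOf S')

end TraceMap

open MvPolynomial

namespace TraceMap

/-! Let `H` be the group generated by the coordinate permutations and the Vieta involution, and `N`
the Klein four-group. `H` normalizes `N`, and `H ∩ N = 1` because `H` fixes (1,1,1).

Markov-type descent identifies 𝒢 with `H` and the invertible part of 𝒜 with `HN`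
(`exists_eq_traceGroup_mul_kleinFour`). In a triple preserving `I` and ordered by degree, either the
cubic term dominates and all degrees are one, or a Vieta move lowers the largest degree. An affine
map preserving `I` is a permutation times a sign change.

The rest is group theory (`isSemidirect_of_normalizing`). If `hn` conjugates `f ∈ H` to `f` or
`f⁻¹`, then `n f n⁻¹ f⁻¹` lies in `N ∩ H = 1`. So `n` commutes with `f`, and `h` acts on `f` as `hn`
does. -/

/-! ### Generators of the group of trace maps -/

/-- The permutation `v ↦ v ∘ e` of the coordinates. -/
def coordPerm (e : Equiv.Perm (Fin 3)) : Equiv.Perm Space where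
  toFun v := fun i => v (e i)
  invFun v := fun i => v (e.symm i)
  left_inv v := by simp
  right_inv v := by simp

@[simp] lemma coordPerm_apply (e : Equiv.Perm (Fin 3)) (v : Space) (i : Fin 3) :
    coordPerm e v i = v (e i) := rfl

lemma coordPerm_inv (e : Equiv.Perm (Fin 3)) : (coordPerm e)⁻¹ = coordPerm e⁻¹ := rfl

/-- The Vieta involution `(x, y, z) ↦ (x, y, 2xy - z)`. -/
def vieta : Equiv.Perm Space :=
  Function.Involutive.toPerm (fun v => ![v 0, v 1, 2 * v 0 * v 1 - v 2]) (by
    intro v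
    ext i
    fin_cases i <;> simp)

@[simp] lemma vieta_apply (v : Space) : vieta v = ![v 0, v 1, 2 * v 0 * v 1 - v 2] := rfl

lemma vieta_mul_self : vieta * vieta = 1 := by
  ext v i
  fin_cases i <;> simp

lemma vieta_inv : vieta⁻¹ = vieta := inv_eq_of_mul_eq_one_left vieta_mul_self

lemma frickeVogt_eq_sum_prod (v : Space) :
    frickeVogt v = ∑ i, v i ^ 2 - 2 * ∏ i, v i - 1 := by
  simp only [frickeVogt, Fin.sum_univ_three, Fin.prod_univ_three]
  ring

lemma frickeVogt_comp_perm (e : Equiv.Perm (Fin 3)) (v : Space) :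
    frickeVogt (fun i => v (e i)) = frickeVogt v := by
  rw [frickeVogt_eq_sum_prod, frickeVogt_eq_sum_prod, Equiv.sum_comp e (fun i => v i ^ 2),
    Equiv.prod_comp e v]

lemma frickeVogt_coordPerm (e : Equiv.Perm (Fin 3)) (v : Space) :
    frickeVogt (coordPerm e v) = frickeVogt v := frickeVogt_comp_perm e v

lemma frickeVogt_vieta (v : Space) : frickeVogt (vieta v) = frickeVogt v := by
  simp [frickeVogt]
  ring

/-- The group generated by the Vieta involution and the permutations of the coordinates. -/
def traceGroup : Subgroup (Equiv.Perm Space) :=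
  Subgroup.closure (insert vieta (Set.range coordPerm))

lemma vieta_mem_traceGroup : vieta ∈ traceGroup :=
  Subgroup.subset_closure (Set.mem_insert _ _)

lemma coordPerm_mem_traceGroup (e : Equiv.Perm (Fin 3)) : coordPerm e ∈ traceGroup :=
  Subgroup.subset_closure (Set.mem_insert_of_mem _ ⟨e, rfl⟩)

/-- Induction on the length of a word in the generators of `traceGroup`. -/
lemma traceGroup_induction {p : Equiv.Perm Space → Prop} (one : p 1)
    (vieta_mul : ∀ g, p g → p (vieta * g)) (coordPerm_mul : ∀ e g, p g → p (coordPerm e * g))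
    {g : Equiv.Perm Space} (hg : g ∈ traceGroup) : p g := by
  induction hg using Subgroup.closure_induction_left with
  | one => exact one
  | mul_left x hx y _ hy =>
    rcases hx with rfl | ⟨e, rfl⟩
    · exact vieta_mul _ hy
    · exact coordPerm_mul _ _ hy
  | inv_mul_cancel x hx y _ hy =>
    rcases hx with rfl | ⟨e, rfl⟩
    · rw [vieta_inv]; exact vieta_mul _ hy
    · rw [coordPerm_inv]; exact coordPerm_mul _ _ hy

/-! ### Klein's four-group -/

@[simp] lemma signChange_apply (i : Fin 3) (v : Space) (j : Fin 3) :
    signChange i v j = if j = i then v j else -v j := rfl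

lemma mem_kleinFour_iff {g : Equiv.Perm Space} :
    g ∈ kleinFour ↔ g = 1 ∨ g = signChange 0 ∨ g = signChange 1 ∨ g = signChange 2 := by
  simp [kleinFour]

lemma signChange_mem_kleinFour (i : Fin 3) : signChange i ∈ kleinFour := by
  fin_cases i <;> simp [kleinFour]

lemma signChange_mul_self (i : Fin 3) : signChange i * signChange i = 1 := by
  ext v j
  by_cases h : j = i <;> simp [h]

lemma mem_kleinFour_iff_exists {g : Equiv.Perm Space} :
    g ∈ kleinFour ↔ g = 1 ∨ ∃ i, g = signChange i := by
  rw [mem_kleinFour_iff]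
  simp [Fin.exists_fin_succ]

/-- Klein's four-group as a subgroup. -/
def kleinSubgroup : Subgroup (Equiv.Perm Space) where
  carrier := kleinFour
  one_mem' := by simp [kleinFour]
  mul_mem' {a b} ha hb := by
    have h01 : signChange 0 * signChange 1 = signChange 2 := by
      ext v j; fin_cases j <;> simp
    have h10 : signChange 1 * signChange 0 = signChange 2 := by
      ext v j; fin_cases j <;> simp
    have h02 : signChange 0 * signChange 2 = signChange 1 := by
      ext v j; fin_cases j <;> simp
    have h20 : signChange 2 * signChange 0 = signChange 1 := by
      ext v j; fin_cases j <;> simp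
    have h12 : signChange 1 * signChange 2 = signChange 0 := by
      ext v j; fin_cases j <;> simp
    have h21 : signChange 2 * signChange 1 = signChange 0 := by
      ext v j; fin_cases j <;> simp
    rw [mem_kleinFour_iff] at ha hb
    rcases ha with rfl | rfl | rfl | rfl <;> rcases hb with rfl | rfl | rfl | rfl <;>
      simp [kleinFour, signChange_mul_self, h01, h10, h02, h20, h12, h21]
  inv_mem' {a} ha := by
    rcases mem_kleinFour_iff_exists.1 ha with rfl | ⟨i, rfl⟩
    · simpa using ha
    · rwa [inv_eq_of_mul_eq_one_left (signChange_mul_self i)]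

lemma mem_kleinSubgroup {g : Equiv.Perm Space} : g ∈ kleinSubgroup ↔ g ∈ kleinFour := Iff.rfl

lemma vieta_mul_signChange (i : Fin 3) : vieta * signChange i = signChange i * vieta := by
  ext v j
  fin_cases i <;> fin_cases j <;> simp <;> ring

lemma coordPerm_mul_signChange (e : Equiv.Perm (Fin 3)) (i : Fin 3) :
    coordPerm e * signChange i = signChange (e.symm i) * coordPerm e := by
  ext v j
  simp [Equiv.eq_symm_apply]

/-- The Vieta involution centralizes the four-group, since under a sign change `xy` and `z` acquire
the same sign; coordinate permutations permute the `signChange i`. -/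
lemma conj_mem_kleinSubgroup {g : Equiv.Perm Space} (hg : g ∈ traceGroup) :
    ∀ n ∈ kleinSubgroup, g * n * g⁻¹ ∈ kleinSubgroup := by
  refine traceGroup_induction (p := fun g => ∀ n ∈ kleinSubgroup, g * n * g⁻¹ ∈ kleinSubgroup)
    (by simp) (fun g ih n hn => ?_) (fun e g ih n hn => ?_) hg
  · rcases mem_kleinFour_iff_exists.1 (ih n hn) with h | ⟨i, h⟩
    · rw [show vieta * g * n * (vieta * g)⁻¹ = vieta * (g * n * g⁻¹) * vieta⁻¹ by group, h]
      simp
    · rw [show vieta * g * n * (vieta * g)⁻¹ = vieta * (g * n * g⁻¹) * vieta⁻¹ by group, h,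
        vieta_mul_signChange, mul_inv_cancel_right]
      exact signChange_mem_kleinFour _
  · have key : coordPerm e * g * n * (coordPerm e * g)⁻¹ =
      coordPerm e * (g * n * g⁻¹) * (coordPerm e)⁻¹ := by group
    rcases mem_kleinFour_iff_exists.1 (ih n hn) with h | ⟨i, h⟩
    · rw [key, h]
      simp
    · rw [key, h, coordPerm_mul_signChange, mul_inv_cancel_right]
      exact signChange_mem_kleinFour _

lemma eq_one_of_mem_kleinFour {g : Equiv.Perm Space} (hg : g ∈ kleinFour)
    (h1 : g (fun _ => 1) = fun _ => 1) : g = 1 := by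
  rcases mem_kleinFour_iff_exists.1 hg with rfl | ⟨i, rfl⟩
  · rfl
  · exfalso
    have h := congrFun h1 (i + 1)
    rw [signChange_apply, if_neg (by fin_cases i <;> decide)] at h
    norm_num at h

lemma frickeVogt_signChange (i : Fin 3) (v : Space) :
    frickeVogt (signChange i v) = frickeVogt v := by
  fin_cases i <;> simp [frickeVogt]

/-! ### Classes of maps stable under the generators -/

/-- A class of maps that is stable under composition with the generators of `traceGroup`. -/
structure IsStable (C : Set (Space → Space)) : Prop where
  coordPerm : ∀ e, ∀ F ∈ C, ⇑(coordPerm e) ∘ F ∈ C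
  vieta : ∀ F ∈ C, ⇑vieta ∘ F ∈ C

lemma IsStable.comp_mem {C : Set (Space → Space)} (hC : IsStable C) {g : Equiv.Perm Space}
    (hg : g ∈ traceGroup) {F : Space → Space} (hF : F ∈ C) : ⇑g ∘ F ∈ C := by
  exact traceGroup_induction (p := fun g => ⇑g ∘ F ∈ C) hF (fun _ ih => hC.vieta _ ih)
    (fun e _ ih => hC.coordPerm e _ ih) hg

section
variable {R : Type} [CommRing R] [Algebra R ℂ]

lemma IsPolynomialMap.coordPerm_comp {F : Space → Space} (hF : IsPolynomialMap R F)
    (e : Equiv.Perm (Fin 3)) : IsPolynomialMap R (⇑(coordPerm e) ∘ F) := by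
  obtain ⟨p, hp⟩ := hF
  exact ⟨fun i => p (e i), fun v i => hp v (e i)⟩

lemma IsPolynomialMap.vieta_comp {F : Space → Space} (hF : IsPolynomialMap R F) :
    IsPolynomialMap R (⇑vieta ∘ F) := by
  obtain ⟨p, hp⟩ := hF
  refine ⟨![p 0, p 1, 2 * p 0 * p 1 - p 2], fun v i => ?_⟩
  fin_cases i <;> simp [hp]

end

lemma IsPolynomialMap.complex {F : Space → Space} (hF : IsPolynomialMap ℤ F) :
    IsPolynomialMap ℂ F := by
  obtain ⟨p, hp⟩ := hF
  refine ⟨fun i => MvPolynomial.map (algebraMap ℤ ℂ) (p i), fun v i => ?_⟩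
  rw [hp, MvPolynomial.aeval_map_algebraMap]

lemma nielsenMaps_subset_invariantMaps : nielsenMaps ⊆ invariantMaps :=
  fun _ hF => ⟨hF.1.complex, hF.2.1⟩

lemma isStable_nielsenMaps : IsStable nielsenMaps where
  coordPerm e _ hF := ⟨hF.1.coordPerm_comp e,
    fun v => (frickeVogt_coordPerm e _).trans (hF.2.1 v), by
      funext i
      simp [hF.2.2]⟩
  vieta _ hF := ⟨hF.1.vieta_comp, fun v => (frickeVogt_vieta _).trans (hF.2.1 v), by
      funext i
      fin_cases i <;> simp [hF.2.2]; norm_num⟩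

lemma isStable_invariantMaps : IsStable invariantMaps where
  coordPerm e _ hF := ⟨hF.1.coordPerm_comp e,
    fun v => (frickeVogt_coordPerm e _).trans (hF.2 v)⟩
  vieta _ hF := ⟨hF.1.vieta_comp, fun v => (frickeVogt_vieta _).trans (hF.2 v)⟩

lemma id_mem_nielsenMaps : id ∈ nielsenMaps :=
  ⟨⟨X, fun v i => by simp⟩, fun _ => rfl, rfl⟩

lemma signChange_mem_invariantMaps (i : Fin 3) : ⇑(signChange i) ∈ invariantMaps := by
  refine ⟨⟨fun j => if j = i then X j else -X j, fun v j => ?_⟩, frickeVogt_signChange i⟩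
  by_cases h : j = i <;> simp [h]

lemma kleinFour_subset_invariantMaps {g : Equiv.Perm Space} (hg : g ∈ kleinFour) :
    ⇑g ∈ invariantMaps := by
  rcases mem_kleinFour_iff_exists.1 hg with rfl | ⟨i, rfl⟩
  · exact nielsenMaps_subset_invariantMaps id_mem_nielsenMaps
  · exact signChange_mem_invariantMaps i

lemma traceGroup_subset_nielsenMaps {g : Equiv.Perm Space} (hg : g ∈ traceGroup) :
    ⇑g ∈ nielsenMaps :=
  isStable_nielsenMaps.comp_mem hg id_mem_nielsenMaps

/-! ### Affine maps preserving the invariant -/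

/-- Compare coefficients, read off by finite differences at points with coordinates in {0, 1, -1}:
`xyz` gives the product of the `a i`, mixed quadratic terms give `b = 0`, squares give `a i = ±1`.
-/
lemma exists_signChange_of_diagonal (a b : Fin 3 → ℂ)
    (h : ∀ v : Space, frickeVogt (fun j => a j * v j + b j) = frickeVogt v) :
    ∃ g ∈ kleinFour, ∀ v, (fun j => a j * v j + b j) = g v := by
  have h' (x y z : ℂ) := h ![x, y, z]
  simp only [frickeVogt, Matrix.cons_val] at h'
  -- The signed sum over the cube's vertices keeps only the `xyz` term: 8 times the coefficient -2.
  have hprod : a 0 * a 1 * a 2 = 1 := by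
    linear_combination (-1 / 16) * (h' 1 1 1 - h' 1 1 (-1) - h' 1 (-1) 1 - h' (-1) 1 1
      + h' 1 (-1) (-1) + h' (-1) 1 (-1) + h' (-1) (-1) 1 - h' (-1) (-1) (-1))
  have h01 : a 0 * a 1 * b 2 = 0 := by
    linear_combination (-1 / 8) * (h' 1 1 0 - h' 1 (-1) 0 - h' (-1) 1 0 + h' (-1) (-1) 0)
  have h02 : a 0 * a 2 * b 1 = 0 := by
    linear_combination (-1 / 8) * (h' 1 0 1 - h' 1 0 (-1) - h' (-1) 0 1 + h' (-1) 0 (-1))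
  have h12 : a 1 * a 2 * b 0 = 0 := by
    linear_combination (-1 / 8) * (h' 0 1 1 - h' 0 1 (-1) - h' 0 (-1) 1 + h' 0 (-1) (-1))
  have hb2 : b 2 = 0 := by linear_combination a 2 * h01 - b 2 * hprod
  have hb1 : b 1 = 0 := by linear_combination a 1 * h02 - b 1 * hprod
  have hb0 : b 0 = 0 := by linear_combination a 0 * h12 - b 0 * hprod
  simp only [hb0, hb1, hb2] at h'
  have s0 : a 0 * a 0 = 1 := by linear_combination h' 1 0 0 - h' 0 0 0
  have s1 : a 1 * a 1 = 1 := by linear_combination h' 0 1 0 - h' 0 0 0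
  have hcases : (a 0 = 1 ∧ a 1 = 1 ∧ a 2 = 1) ∨ (a 0 = 1 ∧ a 1 = -1 ∧ a 2 = -1) ∨
      (a 0 = -1 ∧ a 1 = 1 ∧ a 2 = -1) ∨ (a 0 = -1 ∧ a 1 = -1 ∧ a 2 = 1) := by
    rcases mul_self_eq_one_iff.1 s0 with h0 | h0 <;>
      rcases mul_self_eq_one_iff.1 s1 with h1 | h1 <;> simp only [h0, h1] at hprod ⊢
    · exact Or.inl ⟨trivial, trivial, by linear_combination hprod⟩
    · exact Or.inr (Or.inl ⟨trivial, trivial, by linear_combination -hprod⟩)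
    · exact Or.inr (Or.inr (Or.inl ⟨trivial, trivial, by linear_combination -hprod⟩))
    · exact Or.inr (Or.inr (Or.inr ⟨trivial, trivial, by linear_combination hprod⟩))
  rcases hcases with ⟨h0, h1, h2⟩ | ⟨h0, h1, h2⟩ | ⟨h0, h1, h2⟩ | ⟨h0, h1, h2⟩
  · refine ⟨1, by simp [kleinFour], fun v => ?_⟩
    funext j
    fin_cases j <;> simp [h0, h1, h2, hb0, hb1, hb2]
  · refine ⟨_, signChange_mem_kleinFour 0, fun v => ?_⟩
    funext j
    fin_cases j <;> simp [h0, h1, h2, hb0, hb1, hb2]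
  · refine ⟨_, signChange_mem_kleinFour 1, fun v => ?_⟩
    funext j
    fin_cases j <;> simp [h0, h1, h2, hb0, hb1, hb2]
  · refine ⟨_, signChange_mem_kleinFour 2, fun v => ?_⟩
    funext j
    fin_cases j <;> simp [h0, h1, h2, hb0, hb1, hb2]

/-- Three linear forms with product `xyz` are multiples of the coordinates. -/
lemma exists_perm_of_prod_linear (M : Fin 3 → Fin 3 → ℂ)
    (h : ∀ v : Space, ∏ i, ∑ j, M i j * v j = ∏ j, v j) :
    ∃ e : Equiv.Perm (Fin 3), ∀ j k, k ≠ j → M (e j) k = 0 := by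
  let L : Fin 3 → MvPolynomial (Fin 3) ℂ := fun i => ∑ j, C (M i j) * X j
  have hL (i : Fin 3) (v : Space) : eval v (L i) = ∑ j, M i j * v j := by simp [L]
  have hprod : ∏ i, L i = ∏ j, X j := by
    refine MvPolynomial.funext fun v => ?_
    simp only [map_prod, hL, eval_X, h]
  have hdvd (j : Fin 3) : ∃ i, (X j : MvPolynomial (Fin 3) ℂ) ∣ L i := by
    have hj : (X j : MvPolynomial (Fin 3) ℂ) ∣ ∏ i, L i :=
      hprod ▸ Finset.dvd_prod_of_mem _ (Finset.mem_univ j)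
    obtain ⟨i, -, hi⟩ := (X_prime (i := j)).exists_mem_finset_dvd hj
    exact ⟨i, hi⟩
  choose e he using hdvd
  have hM (j k : Fin 3) (hk : k ≠ j) : M (e j) k = 0 := by
    obtain ⟨q, hq⟩ := he j
    -- At the `k`-th unit vector `X j` vanishes, while the linear form takes the value `M (e j) k`.
    have := congrArg (eval (Pi.single k 1)) hq
    rw [hL, map_mul, eval_X, Pi.single_eq_of_ne hk.symm, zero_mul] at this
    simpa [Pi.single_apply] using this
  have hinj : Function.Injective e := by
    intro j j' hjj
    by_contra hne
    have h0 : ∀ k, M (e j) k = 0 := fun k => by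
      by_cases hk : k = j
      · rw [hjj]
        exact hM j' k (hk ▸ hne)
      · exact hM j k hk
    have h1 := h (fun _ => 1)
    rw [Finset.prod_eq_zero (Finset.mem_univ (e j)) (by simp [h0])] at h1
    simp at h1
  exact ⟨Equiv.ofBijective e (Finite.injective_iff_bijective.1 hinj), hM⟩

/-- The cubic part of `I` is `-2xyz`, so the linear parts of the three coordinates multiply to
`xyz`; hence the linear part is monomial and a permutation reduces to the diagonal case. -/
lemma exists_coordPerm_mul_of_affine (M : Fin 3 → Fin 3 → ℂ) (b : Fin 3 → ℂ)
    (h : ∀ v : Space, frickeVogt (fun i => ∑ j, M i j * v j + b i) = frickeVogt v) :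
    ∃ e, ∃ g ∈ kleinFour, ∀ v : Space,
      (fun i => ∑ j, M i j * v j + b i) = (coordPerm e * g) v := by
  have hcubic (v : Space) : ∏ i, ∑ j, M i j * v j = ∏ j, v j := by
    have ht (t : ℂ) : frickeVogt (fun i => t * (∑ j, M i j * v j) + b i) =
        frickeVogt (fun i => t * v i) := by
      rw [← h (fun i => t * v i)]
      congr 1
      funext i
      rw [Finset.mul_sum]
      congr 1
      exact Finset.sum_congr rfl fun j _ => by ring
    simp only [frickeVogt] at ht
    rw [Fin.prod_univ_three, Fin.prod_univ_three]
    -- The third difference over `t = 0, 1, 2, 3` is 3! times the coefficient of `t³`, which carries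
    -- the factor -2.
    linear_combination (-1 / 12) * (ht 3 - 3 * ht 2 + 3 * ht 1 - ht 0)
  obtain ⟨e, he⟩ := exists_perm_of_prod_linear M hcubic
  have hrow (v : Space) (j : Fin 3) : ∑ k, M (e j) k * v k = M (e j) j * v j :=
    Finset.sum_eq_single _ (fun k _ hk => by rw [he j k hk, zero_mul]) (by simp)
  obtain ⟨g, hg, hgv⟩ := exists_signChange_of_diagonal (fun j => M (e j) j) (fun j => b (e j))
    (fun v => by
      have hv := (frickeVogt_comp_perm e _).trans (h v)
      simpa only [hrow] using hv)
  refine ⟨e.symm, g, hg, fun v => ?_⟩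
  funext i
  rw [Equiv.Perm.mul_apply, coordPerm_apply, ← hgv]
  have := hrow v (e.symm i)
  simp only [Equiv.apply_symm_apply] at this ⊢
  rw [this]

lemma eval_eq_of_totalDegree_le_one {p : MvPolynomial (Fin 3) ℂ} (hp : p.totalDegree ≤ 1)
    (v : Space) : eval v p = ∑ j, coeff (Finsupp.single j 1) p * v j + coeff 0 p := by
  have key : p = ∑ j, C (coeff (Finsupp.single j 1) p) * X j + C (coeff 0 p) := by
    ext m
    simp only [coeff_add, coeff_sum, coeff_C_mul, coeff_X, coeff_C, mul_ite, mul_one, mul_zero]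
    rcases lt_or_ge 1 m.degree with hm | hm
    · rw [coeff_eq_zero_of_totalDegree_lt (lt_of_le_of_lt hp hm), if_neg, add_zero,
        Finset.sum_eq_zero]
      · intro j _
        rw [if_neg]
        rintro rfl
        simp at hm
      · rintro rfl
        simp at hm
    · rcases Nat.le_one_iff_eq_zero_or_eq_one.1 hm with hm | hm
      · obtain rfl := (Finsupp.degree_eq_zero_iff m).1 hm
        simp
      · obtain ⟨i, rfl⟩ : m ∈ Set.range fun i : Fin 3 => Finsupp.single i 1 := by
          rwa [Finsupp.range_single_one]
        simp [Finsupp.single_left_inj, eq_comm]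
  conv_lhs => rw [key]
  simp

/-! ### Descent on the degrees -/

/-- The Fricke–Vogt invariant of a triple of polynomials. -/
noncomputable def frickePoly (p : Fin 3 → MvPolynomial (Fin 3) ℂ) : MvPolynomial (Fin 3) ℂ :=
  p 0 ^ 2 + p 1 ^ 2 + p 2 ^ 2 - 1 - C 2 * p 0 * p 1 * p 2

lemma eval_frickePoly (p : Fin 3 → MvPolynomial (Fin 3) ℂ) (v : Space) :
    eval v (frickePoly p) = frickeVogt (fun i => eval v (p i)) := by
  simp [frickePoly, frickeVogt]
  ring

/-- Under `h2` the cubic term has degree larger than twice the maximal degree, so the squares cannot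
cancel it. -/
lemma totalDegree_frickePoly (p : Fin 3 → MvPolynomial (Fin 3) ℂ) (hne : ∀ i, p i ≠ 0)
    (h0 : (p 0).totalDegree ≤ (p 2).totalDegree) (h1 : (p 1).totalDegree ≤ (p 2).totalDegree)
    (h2 : (p 2).totalDegree < (p 0).totalDegree + (p 1).totalDegree) :
    (frickePoly p).totalDegree =
      (p 0).totalDegree + (p 1).totalDegree + (p 2).totalDegree := by
  have hc : (C 2 : MvPolynomial (Fin 3) ℂ) ≠ 0 := by simp
  have hmul : (-(C 2 * p 0 * p 1 * p 2)).totalDegree =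
      (p 0).totalDegree + (p 1).totalDegree + (p 2).totalDegree := by
    rw [totalDegree_neg, totalDegree_mul_of_isDomain (by simp [hne]) (hne 2),
      totalDegree_mul_of_isDomain (by simp [hne]) (hne 1),
      totalDegree_mul_of_isDomain hc (hne 0), totalDegree_C, zero_add]
  have hsq : (p 0 ^ 2 + p 1 ^ 2 + p 2 ^ 2 - 1).totalDegree ≤ 2 * (p 2).totalDegree := by
    have e0 := totalDegree_pow (p 0) 2
    have e1 := totalDegree_pow (p 1) 2
    have e2 := totalDegree_pow (p 2) 2
    refine (totalDegree_sub _ _).trans (max_le ?_ (by simp))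
    refine (totalDegree_add _ _).trans (max_le ?_ (by omega))
    exact (totalDegree_add _ _).trans (max_le (by omega) (by omega))
  rw [frickePoly, sub_eq_add_neg, totalDegree_add_eq_right_of_totalDegree_lt (by omega), hmul]

lemma totalDegree_frickePoly_X : (frickePoly X).totalDegree = 3 := by
  rw [totalDegree_frickePoly] <;> simp [totalDegree_X]

/-- In a triple of non-constant polynomials preserving the invariant, ordered by degree, either
all degrees are one or the Vieta involution lowers the largest degree. -/
lemma totalDegree_le_one_or_vieta_lt (p : Fin 3 → MvPolynomial (Fin 3) ℂ)
    (hp : frickePoly p = frickePoly X) (hmono : Monotone fun i => (p i).totalDegree)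
    (hpos : ∀ i, (p i).totalDegree ≠ 0) (hv : (C 2 * p 0 * p 1 - p 2).totalDegree ≠ 0) :
    (∀ i, (p i).totalDegree ≤ 1) ∨
      (C 2 * p 0 * p 1 - p 2).totalDegree < (p 2).totalDegree := by
  have hne : ∀ i, p i ≠ 0 := fun i hi => hpos i (by simp [hi])
  have hvne : C 2 * p 0 * p 1 - p 2 ≠ 0 := fun hi => hv (by rw [hi, totalDegree_zero])
  have h01 : (p 0).totalDegree ≤ (p 1).totalDegree := hmono (by decide)
  have h12 : (p 1).totalDegree ≤ (p 2).totalDegree := hmono (by decide)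
  have p0 := hpos 0
  have p1 := hpos 1
  have p2 := hpos 2
  by_cases hlt : (p 2).totalDegree < (p 0).totalDegree + (p 1).totalDegree
  · left
    have hdeg := totalDegree_frickePoly p hne (h01.trans h12) h12 hlt
    rw [hp, totalDegree_frickePoly_X] at hdeg
    intro i
    fin_cases i <;> simp only [Fin.zero_eta, Fin.mk_one, Fin.reduceFinMk] <;> omega
  · right
    -- With the first two entries fixed, `p 2` and its Vieta image are the roots of a monic
    -- quadratic, whose constant term is the right-hand side. As `p 2` has degree at least 2 and
    -- above that of `p 1`, the other root has smaller degree.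
    have hmul : p 2 * (C 2 * p 0 * p 1 - p 2) = p 0 ^ 2 + p 1 ^ 2 - 1 - frickePoly X := by
      rw [← hp, frickePoly]
      ring
    have hle : (p 0 ^ 2 + p 1 ^ 2 - 1 - frickePoly X).totalDegree ≤
        max (2 * (p 1).totalDegree) 3 := by
      have e0 := totalDegree_pow (p 0) 2
      have e1 := totalDegree_pow (p 1) 2
      refine (totalDegree_sub _ _).trans (max_le_max ?_ totalDegree_frickePoly_X.le)
      refine (totalDegree_sub _ _).trans (max_le ?_ (by simp))
      exact (totalDegree_add _ _).trans (max_le (by omega) (by omega))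
    rw [← hmul, totalDegree_mul_of_isDomain (hne 2) hvne] at hle
    omega

lemma totalDegree_ne_zero_of_not_const {p : MvPolynomial (Fin 3) ℂ}
    (h : ∀ c, ¬ ∀ v : Space, eval v p = c) : p.totalDegree ≠ 0 := by
  intro h0
  rw [totalDegree_eq_zero_iff_eq_C] at h0
  exact h (coeff 0 p) fun v => by rw [h0]; simp

/-- Polynomial maps preserving the invariant, in a stable class of maps without constant
coordinates, are products of generators and a sign change. -/
theorem exists_eq_traceGroup_mul_kleinFour {S : Set (Space → Space)} (hS : IsStable S)
    (hinv : S ⊆ invariantMaps) (hconst : ∀ F ∈ S, ∀ i c, ¬ ∀ v, F v i = c)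
    {F : Space → Space} (hF : F ∈ S) :
    ∃ w ∈ traceGroup, ∃ g ∈ kleinFour, F = ⇑(w * g) := by
  obtain ⟨p, hp⟩ := (hinv hF).1
  replace hp : ∀ v i, F v i = eval v (p i) := fun v i => by rw [hp, aeval_eq_eval]
  induction hn : ∑ i, (p i).totalDegree using Nat.strong_induction_on generalizing F p with
  | _ n ih =>
    -- Sorting by a generator keeps the sum of degrees, the quantity of the induction.
    let e := Tuple.sort fun i => (p i).totalDegree
    let q : Fin 3 → MvPolynomial (Fin 3) ℂ := fun i => p (e i)
    let G : Space → Space := ⇑(coordPerm e) ∘ F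
    have hG : G ∈ S := hS.coordPerm e F hF
    have hq (v : Space) (i : Fin 3) : G v i = eval v (q i) := hp v (e i)
    have hmono : Monotone fun i => (q i).totalDegree :=
      Tuple.monotone_sort fun i => (p i).totalDegree
    have hsum : ∑ i, (q i).totalDegree = n :=
      (Equiv.sum_comp e fun i => (p i).totalDegree).trans hn
    suffices ∃ w ∈ traceGroup, ∃ g ∈ kleinFour, G = ⇑(w * g) by
      obtain ⟨w, hw, g, hg, h⟩ := this
      refine ⟨(coordPerm e)⁻¹ * w, mul_mem (inv_mem (coordPerm_mem_traceGroup e)) hw, g, hg, ?_⟩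
      rw [mul_assoc, Equiv.Perm.coe_mul, ← h]
      funext v
      exact ((coordPerm e).symm_apply_apply (F v)).symm
    have hV : ⇑vieta ∘ G ∈ S := hS.vieta G hG
    let q' : Fin 3 → MvPolynomial (Fin 3) ℂ := ![q 0, q 1, C 2 * q 0 * q 1 - q 2]
    have hq' (v : Space) (i : Fin 3) : (⇑vieta ∘ G) v i = eval v (q' i) := by
      fin_cases i <;> simp [q', hq]
    have hinvq : frickePoly q = frickePoly X := by
      refine MvPolynomial.funext fun v => ?_
      rw [eval_frickePoly, eval_frickePoly]
      simp only [← hq, eval_X]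
      exact (hinv hG).2 v
    rcases totalDegree_le_one_or_vieta_lt q hinvq hmono
      (fun i => totalDegree_ne_zero_of_not_const fun c h => hconst G hG i c
        fun v => (hq v i).trans (h v))
      (totalDegree_ne_zero_of_not_const fun c h => hconst _ hV 2 c
        fun v => (hq' v 2).trans (h v)) with h | h
    · have haff (v : Space) : G v = fun i => ∑ j, coeff (Finsupp.single j 1) (q i) * v j +
          coeff 0 (q i) := by
        funext i
        rw [hq, eval_eq_of_totalDegree_le_one (h i)]
      obtain ⟨e', g, hg, hgv⟩ := exists_coordPerm_mul_of_affine
        (fun i j => coeff (Finsupp.single j 1) (q i)) (fun i => coeff 0 (q i))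
        (fun v => by rw [← haff]; exact (hinv hG).2 v)
      exact ⟨coordPerm e', coordPerm_mem_traceGroup e', g, hg,
        _root_.funext fun v => (haff v).trans (hgv v)⟩
    · have hlt : ∑ i, (q' i).totalDegree < n := by
        rw [← hsum, Fin.sum_univ_three, Fin.sum_univ_three]
        simpa [q'] using h
      obtain ⟨w, hw, g, hg, hwg⟩ := ih _ hlt hV q' hq' rfl
      refine ⟨vieta * w, mul_mem vieta_mem_traceGroup hw, g, hg, ?_⟩
      rw [mul_assoc, Equiv.Perm.coe_mul, ← hwg]
      funext v
      exact (congrArg (fun f : Equiv.Perm Space => f (G v)) vieta_mul_self).symm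

/-! ### The groups of invertible maps in the two classes -/

/-- By the fixed point (1,1,1) the constant would be 1. But `I(1,y,z) = (y-z)²`, so `I` would be the
square of a polynomial, although its degree 3 is odd. -/
lemma not_const_of_mem_nielsenMaps {F : Space → Space} (hF : F ∈ nielsenMaps) (i : Fin 3) (c : ℂ) :
    ¬ ∀ v, F v i = c := by
  intro h
  wlog hi : i = 0 generalizing F i
  · exact this (isStable_nielsenMaps.coordPerm (Equiv.swap 0 i) F hF) 0
      (fun v => by simpa using h v) rfl
  subst hi
  obtain rfl : c = 1 := by rw [← h fun _ => 1, hF.2.2]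
  obtain ⟨p, hp⟩ := hF.1.complex
  replace hp : ∀ v i, F v i = eval v (p i) := fun v i => by rw [hp, aeval_eq_eval]
  have hsq : (p 1 - p 2) ^ 2 = frickePoly X := by
    refine MvPolynomial.funext fun v => ?_
    rw [eval_frickePoly]
    simp only [eval_X]
    rw [← hF.2.1 v, frickeVogt, h v, hp, hp]
    simp
    ring
  have hdeg := congrArg totalDegree hsq
  have hne : p 1 - p 2 ≠ 0 := by
    intro h0
    rw [h0, totalDegree_frickePoly_X] at hdeg
    simp at hdeg
  rw [totalDegree_frickePoly_X, pow_two, totalDegree_mul_of_isDomain hne hne] at hdeg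
  omega

/-- The Nielsen trace maps are invertible; they are the elements of `traceGroup`. -/
theorem mem_nielsenMaps_iff {F : Space → Space} :
    F ∈ nielsenMaps ↔ ∃ w ∈ traceGroup, F = ⇑w := by
  constructor
  · intro hF
    obtain ⟨w, hw, g, hg, rfl⟩ := exists_eq_traceGroup_mul_kleinFour isStable_nielsenMaps
      nielsenMaps_subset_invariantMaps (fun F hF => not_const_of_mem_nielsenMaps hF) hF
    refine ⟨w, hw, ?_⟩
    rw [eq_one_of_mem_kleinFour hg, mul_one]
    apply w.injective
    exact hF.2.2.trans (traceGroup_subset_nielsenMaps hw).2.2.symm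
  · rintro ⟨w, hw, rfl⟩
    exact traceGroup_subset_nielsenMaps hw

lemma coe_mem_nielsenMaps_iff {g : Equiv.Perm Space} : ⇑g ∈ nielsenMaps ↔ g ∈ traceGroup := by
  rw [mem_nielsenMaps_iff]
  constructor
  · rintro ⟨w, hw, h⟩
    rwa [DFunLike.coe_injective h]
  · exact fun hg => ⟨g, hg, rfl⟩

/-- The invertible maps in `invariantMaps` are the products of an element of `traceGroup` and a
sign change. -/
theorem coe_mem_invariantMaps_iff {A : Equiv.Perm Space} :
    ⇑A ∈ invariantMaps ↔ ∃ w ∈ traceGroup, ∃ g ∈ kleinSubgroup, A = w * g := by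
  constructor
  · intro hA
    -- Surjectivity excludes constant coordinates and survives the generators. Without it the
    -- descent fails: `(0, 1 + I/2, iI/2)` also preserves `I`.
    let S : Set (Space → Space) := {F | F ∈ invariantMaps ∧ Function.Surjective F}
    have hS : IsStable S :=
      { coordPerm := fun e _ hF =>
          ⟨isStable_invariantMaps.coordPerm e _ hF.1, (coordPerm e).surjective.comp hF.2⟩
        vieta := fun _ hF =>
          ⟨isStable_invariantMaps.vieta _ hF.1, vieta.surjective.comp hF.2⟩ }
    have hconst : ∀ F ∈ S, ∀ i c, ¬ ∀ v, F v i = c := by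
      intro F hF i c h
      obtain ⟨v, hv⟩ := hF.2 fun _ => c + 1
      have := h v
      rw [hv] at this
      simp at this
    obtain ⟨w, hw, g, hg, h⟩ := exists_eq_traceGroup_mul_kleinFour hS (fun _ hF => hF.1) hconst
      (show ⇑A ∈ S from ⟨hA, A.surjective⟩)
    exact ⟨w, hw, g, hg, DFunLike.coe_injective h⟩
  · rintro ⟨w, hw, g, hg, rfl⟩
    exact isStable_invariantMaps.comp_mem hw (kleinFour_subset_invariantMaps hg)

/-! ### Semidirect products inside centralizers -/

/-- The subgroup of the elements conjugating `f` into `f` or `f⁻¹`. -/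
def reversingSubgroup {Γ : Type} [Group Γ] (f : Γ) : Subgroup Γ where
  carrier := {g | g * f * g⁻¹ = f ∨ g * f * g⁻¹ = f⁻¹}
  one_mem' := by simp
  mul_mem' {a b} ha hb := by
    have key : a * b * f * (a * b)⁻¹ = a * (b * f * b⁻¹) * a⁻¹ := by group
    have hinv : a * f⁻¹ * a⁻¹ = (a * f * a⁻¹)⁻¹ := by group
    rw [Set.mem_ofPred_eq, key]
    rcases hb with hb | hb <;> rcases ha with ha | ha <;> simp [hb, hinv, ha]
  inv_mem' {a} ha := by
    rcases ha with ha | ha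
    · left
      conv_lhs => rw [← ha]
      group
    · right
      have h : f = (a * f * a⁻¹)⁻¹ := by rw [ha, inv_inv]
      conv_lhs => rw [h]
      group

lemma mem_reversingSubgroup {Γ : Type} [Group Γ] {f g : Γ} :
    g ∈ reversingSubgroup f ↔ g * f * g⁻¹ = f ∨ g * f * g⁻¹ = f⁻¹ := Iff.rfl

/-- The commutator `n f n⁻¹ f⁻¹` is in `N` because `f` normalizes `N`, and in `H` after undoing the
conjugation by `h`; so it is trivial. -/
lemma mul_comm_of_conj_mem {Γ : Type} [Group Γ] {N H : Subgroup Γ}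
    (hnorm : ∀ h ∈ H, ∀ n ∈ N, h * n * h⁻¹ ∈ N) (hdisj : ∀ g ∈ N, g ∈ H → g = 1) {f h n : Γ}
    (hf : f ∈ H) (hh : h ∈ H) (hn : n ∈ N) (hconj : h * n * f * (h * n)⁻¹ ∈ H) :
    n * f = f * n := by
  have h1 : n * (f * n⁻¹ * f⁻¹) ∈ N := mul_mem hn (hnorm f hf _ (inv_mem hn))
  have h2 : n * (f * n⁻¹ * f⁻¹) ∈ H := by
    have : n * (f * n⁻¹ * f⁻¹) = h⁻¹ * (h * n * f * (h * n)⁻¹) * h * f⁻¹ := by group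
    rw [this]
    exact mul_mem (mul_mem (mul_mem (inv_mem hh) hconj) hh) (inv_mem hf)
  have h3 := hdisj _ h1 h2
  rw [← mul_inv_eq_one, ← h3]
  group

/-- Let `H` normalize `N` with `N ∩ H = 1`, let `f ∈ H`, and let `D` be a group of elements
conjugating `f` into `f` or `f⁻¹` that contains the centralizer of `f`. Then the intersection of
`HN` with `D` is the semidirect product of the centralizer of `f` in `N` and `H ∩ D`. -/
theorem isSemidirect_of_normalizing {Γ : Type} [Group Γ] {N H D : Subgroup Γ}
    (hnorm : ∀ h ∈ H, ∀ n ∈ N, h * n * h⁻¹ ∈ N) (hdisj : ∀ g ∈ N, g ∈ H → g = 1) {f : Γ}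
    (hf : f ∈ H) (hD : D ≤ reversingSubgroup f) (hcent : ∀ g, g * f = f * g → g ∈ D) :
    IsSemidirect {g | (∃ h ∈ H, ∃ n ∈ N, g = h * n) ∧ g ∈ D} {g | g ∈ N ∧ g * f = f * g}
      {g | g ∈ H ∧ g ∈ D} := by
  have hconj {g : Γ} (hg : g ∈ D) : g * f * g⁻¹ ∈ H := by
    rcases hD hg with h | h <;> rw [h]
    exacts [hf, inv_mem hf]
  have hcomm {h n : Γ} (hh : h ∈ H) (hn : n ∈ N) (hhn : h * n ∈ D) : n * f = f * n :=
    mul_comm_of_conj_mem hnorm hdisj hf hh hn (hconj hhn)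
  let S : Subgroup Γ :=
    { carrier := {g | (∃ h ∈ H, ∃ n ∈ N, g = h * n) ∧ g ∈ D}
      one_mem' := ⟨⟨1, one_mem _, 1, one_mem _, by simp⟩, one_mem _⟩
      mul_mem' := by
        rintro _ _ ⟨⟨h, hh, n, hn, rfl⟩, hD₁⟩ ⟨⟨h', hh', n', hn', rfl⟩, hD₂⟩
        refine ⟨⟨h * h', mul_mem hh hh', (h'⁻¹ * n * h'⁻¹⁻¹) * n',
          mul_mem (hnorm _ (inv_mem hh') _ hn) hn', by group⟩, mul_mem hD₁ hD₂⟩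
      inv_mem' := by
        rintro _ ⟨⟨h, hh, n, hn, rfl⟩, hD₁⟩
        exact ⟨⟨h⁻¹, inv_mem hh, h * n⁻¹ * h⁻¹, hnorm h hh _ (inv_mem hn), by group⟩,
          inv_mem hD₁⟩ }
  let K : Subgroup Γ := N ⊓ Subgroup.centralizer {f}
  have hK {g : Γ} : g ∈ K ↔ g ∈ N ∧ g * f = f * g := by
    simp [K, Subgroup.mem_inf, Subgroup.mem_centralizer_singleton_iff, eq_comm]
  have hKS : K ≤ S := fun g hg =>
    ⟨⟨1, one_mem _, g, (hK.1 hg).1, by simp⟩, hcent g (hK.1 hg).2⟩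
  have hHS : H ⊓ D ≤ S := fun g hg => ⟨⟨g, hg.1, 1, one_mem _, by simp⟩, hg.2⟩
  refine ⟨S, K, H ⊓ D, rfl, Set.ext fun g => hK, rfl, hKS, hHS, ⟨?_⟩, ?_⟩
  · rintro ⟨k, hkS⟩ hk ⟨g, hg⟩
    rw [Subgroup.mem_subgroupOf] at hk ⊢
    have hk' := hK.1 hk
    obtain ⟨⟨h, hh, n, hn, rfl⟩, hgD⟩ := hg
    have hN : h * n * k * (h * n)⁻¹ ∈ N := by
      have : h * n * k * (h * n)⁻¹ = h * (n * k * n⁻¹) * h⁻¹ := by group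
      rw [this]
      exact hnorm h hh _ (mul_mem (mul_mem hn hk'.1) (inv_mem hn))
    -- The conjugate lies in both `N` and `D`, so the commutator argument with `h = 1` makes it
    -- commute with `f`.
    refine hK.2 ⟨hN, mul_comm_of_conj_mem hnorm hdisj hf (one_mem H) hN ?_⟩
    rw [one_mul]
    exact hconj (mul_mem (mul_mem hgD (hcent k hk'.2)) (inv_mem hgD))
  · apply Subgroup.isComplement'_of_disjoint_and_mul_eq_univ
    · rw [Subgroup.disjoint_def]
      rintro ⟨g, hg⟩ hgK hgH
      rw [Subgroup.mem_subgroupOf] at hgK hgH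
      exact Subtype.ext (hdisj g (hK.1 hgK).1 hgH.1)
    · refine Set.eq_univ_of_forall ?_
      rintro ⟨g, hg⟩
      obtain ⟨⟨h, hh, n, hn, rfl⟩, hgD⟩ := hg
      have hnf := hcomm hh hn hgD
      have hhD : h ∈ D := by simpa using mul_mem hgD (inv_mem (hcent n hnf))
      have hconjD : h * n * h⁻¹ ∈ D := mul_mem hgD (inv_mem hhD)
      have hN := hnorm h hh n hn
      have hkK : h * n * h⁻¹ ∈ K := by
        refine hK.2 ⟨hN, mul_comm_of_conj_mem hnorm hdisj hf (one_mem H) hN ?_⟩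
        rw [one_mul]
        exact hconj hconjD
      -- Rewriting `hn` as `(h n h⁻¹) h` puts the normal factor first.
      refine Set.mem_mul.2 ⟨⟨_, hKS hkK⟩, hkK, ⟨h, hHS ⟨hh, hhD⟩⟩, ⟨hh, hhD⟩, ?_⟩
      exact Subtype.ext (by simp)

lemma eq_one_of_mem_kleinSubgroup_of_mem_traceGroup (g : Equiv.Perm Space)
    (hg : g ∈ kleinSubgroup) (hg' : g ∈ traceGroup) : g = 1 :=
  eq_one_of_mem_kleinFour hg (traceGroup_subset_nielsenMaps hg').2.2

lemma symmetries_eq (B : Set (Space → Space)) (Φ : Equiv.Perm Space) :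
    symmetries B Φ =
      {g : Equiv.Perm Space | ⇑g ∈ B ∧ g ∈ Subgroup.centralizer {Φ}} := by
  ext g
  simp only [symmetries, Set.mem_ofPred_eq, Subgroup.mem_centralizer_singleton_iff]
  rw [eq_comm (a := Φ * g)]

lemma reversingSymmetryGroup_eq (B : Set (Space → Space)) (Φ : Equiv.Perm Space) :
    reversingSymmetryGroup B Φ =
      {g : Equiv.Perm Space | ⇑g ∈ B ∧ g ∈ reversingSubgroup Φ} := by
  ext g
  simp only [reversingSymmetryGroup, symmetries, reversingSymmetries, Set.mem_union,
    Set.mem_ofPred_eq, mem_reversingSubgroup, mul_inv_eq_iff_eq_mul, eq_comm (a := Φ * g),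
    ← and_or_left]

end TraceMap

theorem theorem3 (F : TraceMap.Space → TraceMap.Space) (hF : F ∈ TraceMap.nielsenMaps) :
    ∃ Φ : Equiv.Perm TraceMap.Space, ⇑Φ = F ∧
      TraceMap.IsSemidirect
        (TraceMap.symmetries TraceMap.invariantMaps Φ)
        (TraceMap.kleinCentralizer Φ)
        (TraceMap.symmetries TraceMap.nielsenMaps Φ) ∧
      (TraceMap.IsTrulyReversible TraceMap.invariantMaps Φ →
        TraceMap.IsSemidirect
          (TraceMap.reversingSymmetryGroup TraceMap.invariantMaps Φ)
          (TraceMap.kleinCentralizer Φ)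
          (TraceMap.reversingSymmetryGroup TraceMap.nielsenMaps Φ)) := by
  obtain ⟨Φ, hΦ, rfl⟩ := TraceMap.mem_nielsenMaps_iff.1 hF
  refine ⟨Φ, rfl, ?_, fun _ => ?_⟩
  -- Here `D` is the centralizer of `Φ`; in the reversing case it is `reversingSubgroup Φ`.
  · simp only [TraceMap.symmetries_eq, TraceMap.coe_mem_nielsenMaps_iff,
      TraceMap.coe_mem_invariantMaps_iff]
    refine TraceMap.isSemidirect_of_normalizing (fun h hh => TraceMap.conj_mem_kleinSubgroup hh)
      TraceMap.eq_one_of_mem_kleinSubgroup_of_mem_traceGroup hΦ (fun g hg => Or.inl ?_)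
      (fun g hg => ?_)
    · rw [Subgroup.mem_centralizer_singleton_iff] at hg
      rw [mul_inv_eq_iff_eq_mul, hg]
    · rw [Subgroup.mem_centralizer_singleton_iff, hg]
  · simp only [TraceMap.reversingSymmetryGroup_eq, TraceMap.coe_mem_nielsenMaps_iff,
      TraceMap.coe_mem_invariantMaps_iff]
    exact TraceMap.isSemidirect_of_normalizing (fun h hh => TraceMap.conj_mem_kleinSubgroup hh)
      TraceMap.eq_one_of_mem_kleinSubgroup_of_mem_traceGroup hΦ le_rfl
      (fun g hg => Or.inl (mul_inv_eq_iff_eq_mul.2 hg))
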